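/- Let $M$ be a manifold which is smooth or real analytic ($\mathbb K=\mathbb R$) or holomorphic ($\mathbb K=\mathbb C$), and let $\mathfrak F$ be a singular foliation on $M$, i.e. a locally finitely generated subsheaf of $\mathcal O$-modules of the sheaf of vector fields $\mathfrak X_M$, stable under the Lie bracket. Let $$\cdots\to E_{-3}\xrightarrow{d^{(3)}}E_{-2}\xrightarrow{d^{(2)}}E_{-1}\xrightarrow{\rho}TM$$ be a geometric resolution of $\mathfrak F$ (of finite or infinite length): a complex of vector bundles of finite rank such that $\cdots\to\Gamma(E_{-2})\to\Gamma(E_{-1})\xrightarrow{\rho}\mathfrak F\to 0$ is an exact sequence of sheaves. Let $(E,(\ell_k)_{k\ge1},\rho)$ be a universal Lie $\infty$-algebroid of $\mathfrak F$ built on it: graded symmetric brackets $\ell_k$ of degree $+1$ on the sheaf of sections of $E=\bigoplus_{i\ge1}E_{-i}$ that satisfy the higher Jacobi identities, with $\ell_1=d$ on $\Gamma(E_{-i})$ for $i\ge2$, with $\ell_k$ $\mathcal O$-multilinear for $k\ne2$, and with $\ell_2(e,fe')=f\,\ell_2(e,e')+\rho(e)[f]\,e'$ for all homogeneous sections $e,e'$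 and functions $f$, where $\rho(e)=0$ if $e$ has degree $\le-2$. For $x\in M$, the bracket $\{u,v\}_2:=\ell_2(s,t)|_x$, where $s,t$ are local sections with $s(x)=u$, $t(x)=v$, is well defined for $u,v$ homogeneous in $\ker\rho_x\oplus\bigoplus_{i\ge2}E_{-i}|_x$. Let $\mathrm{Gr}(E_{-i})\to M$ be the bundle of Grassmannians of linear subspaces of the fibres of $E_{-i}$. Let $\pi_1\colon\widetilde M_1\to M$ be the closure in $\mathrm{Gr}(E_{-1})$ of the set of all $\mathrm{im}(d^{(2)}_y)$, where $y$ runs through the points with a neighbourhood on which $d^{(2)}$ has constant rank. Let $\pi_\infty\colon\widetilde M_\infty\to M$ be the closure, in the fibre product over $M$ of all $\mathrm{Gr}(E_{-i})$, $i\ge1$, of the set of all families $(\mathrm{im}(d^{(i+1)}_y))_{i\ge1}$, where $y$ runs through the regular points of $\mathfrak F$, i.e. those with a neighbourhood on which $\rho$ has constant rank. Then: 1. For every $x\in M$ and $V\in\pi_1^{-1}(x)$ one has $V\subseteq\ker\rho_x$, and the bracket $\{\cdot,\cdot\}_2$ on $\ker\rho_x$ restricts to $V$: $\{V,V\}_2\subseteq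 V$. 2. For every $x\in M$ and $(V_1,V_2,\dots)\in\pi_\infty^{-1}(x)$ (so $V_i\subseteq E_{-i}|_x$) one has $V_1\subseteq\ker\rho_x$ and $\{V_i,V_j\}_2\subseteq V_{i+j-1}$ for all $i,j\ge1$. -/

import Mathlib

open Bundle TopologicalSpace
open scoped Manifold ContDiff DirectSum

noncomputable section

/-! ## Sheaves of sections of a vector bundle

`M` is a manifold modelled on the finite-dimensional `𝕜`-vector space `B`, of class `C^n` with
`n ≥ ∞`: smooth or real analytic if `𝕜 = ℝ`, holomorphic if `𝕜 = ℂ`. -/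

section Sections

variable (𝕜 : Type*) [RCLike 𝕜] (B : Type*) [NormedAddCommGroup B] [NormedSpace 𝕜 B]
  {M : Type*} [TopologicalSpace M] [ChartedSpace B M] (n : WithTop ℕ∞)

/-- `f` is a function of class `C^n` on `U`; its values outside `U` play no role. -/
def IsFun (U : Opens M) (f : M → 𝕜) : Prop :=
  ContMDiffOn 𝓘(𝕜, B) 𝓘(𝕜, 𝕜) n f U

/-- The derivative `X[f]` at `x` of the function `f` in the direction of the tangent vector `X`. -/
def dirDeriv (f : M → 𝕜) (x : M) (X : TangentSpace 𝓘(𝕜, B) x) : 𝕜 :=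
  mfderiv 𝓘(𝕜, B) 𝓘(𝕜, 𝕜) f x X

variable (F : Type*) [NormedAddCommGroup F] [NormedSpace 𝕜 F]
  (E : M → Type*) [TopologicalSpace (TotalSpace F E)]
  [∀ x, AddCommGroup (E x)] [∀ x, Module 𝕜 (E x)] [∀ x, TopologicalSpace (E x)]
  [FiberBundle F E] [VectorBundle 𝕜 F E]

/-- The space `Γ_U(E)` of sections of `E` of class `C^n` over the open set `U`. A section over `U`
is represented by its extension by zero to `M`, which need not be continuous outside `U`. -/
def Sec (U : Opens M) : Submodule 𝕜 (∀ x : M, E x) where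
  carrier := {s | ContMDiffOn 𝓘(𝕜, B) (𝓘(𝕜, B).prod 𝓘(𝕜, F)) n
      (fun x => TotalSpace.mk' F x (s x)) U ∧ ∀ x ∉ U, s x = 0}
  add_mem' := by
    intro s t hs ht
    exact ⟨hs.1.add_section ht.1, fun x hx => by simp [hs.2 x hx, ht.2 x hx]⟩
  zero_mem' := ⟨(contMDiff_zeroSection 𝕜 E).contMDiffOn, fun _ _ => rfl⟩
  smul_mem' := by
    intro c s hs
    exact ⟨hs.1.const_smul_section, fun x hx => by simp [hs.2 x hx]⟩

variable {E}

open Classical in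
/-- The restriction of a (not necessarily regular) section to `U`, extended by zero. -/
def restr (U : Opens M) (s : ∀ x : M, E x) : ∀ x : M, E x :=
  fun x => if x ∈ U then s x else 0

variable (E)

/-- The restriction map `Γ_U(E) → Γ_V(E)` for `V ⊆ U`. -/
def Sec.res {U V : Opens M} (h : V ≤ U) : Sec 𝕜 B n F E U →ₗ[𝕜] Sec 𝕜 B n F E V where
  toFun s := ⟨restr V s.1, by
    refine ⟨(s.2.1.mono h).congr fun x hx => ?_, fun x hx => if_neg hx⟩
    have hx' : x ∈ V := hx
    simp [restr, hx']⟩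
  map_add' s t := by
    ext x
    by_cases hx : x ∈ V <;> simp [restr, hx]
  map_smul' c s := by
    ext x
    by_cases hx : x ∈ V <;> simp [restr, hx]

variable {𝕜 B n}

/-- Multiplication of sections over `U` by a function `f` on `U`. -/
def Sec.mul {U : Opens M} (f : M → 𝕜) (hf : IsFun 𝕜 B n U f) :
    Sec 𝕜 B n F E U →ₗ[𝕜] Sec 𝕜 B n F E U where
  toFun s := ⟨fun x => f x • s.1 x,
    ⟨ContMDiffOn.smul_section hf s.2.1, fun x hx => by simp [s.2.2 x hx]⟩⟩
  map_add' s t := by ext x; simp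
  map_smul' c s := by ext x; simp [smul_comm c]

end Sections

/-! ## Morphisms of vector bundles and Nash blowups -/

section Nash

variable (𝕜 : Type*) [RCLike 𝕜] (B : Type*) [NormedAddCommGroup B] [NormedSpace 𝕜 B]
  {M : Type*} [TopologicalSpace M] [ChartedSpace B M] (n : WithTop ℕ∞)
  (F₁ : Type*) [NormedAddCommGroup F₁] [NormedSpace 𝕜 F₁]
  (E₁ : M → Type*) [TopologicalSpace (TotalSpace F₁ E₁)]
  [∀ x, AddCommGroup (E₁ x)] [∀ x, Module 𝕜 (E₁ x)] [∀ x, TopologicalSpace (E₁ x)]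
  [FiberBundle F₁ E₁] [VectorBundle 𝕜 F₁ E₁]
  (F₂ : Type*) [NormedAddCommGroup F₂] [NormedSpace 𝕜 F₂]
  (E₂ : M → Type*) [TopologicalSpace (TotalSpace F₂ E₂)]
  [∀ x, AddCommGroup (E₂ x)] [∀ x, Module 𝕜 (E₂ x)] [∀ x, TopologicalSpace (E₂ x)]
  [FiberBundle F₂ E₂] [VectorBundle 𝕜 F₂ E₂]

/-- A morphism of vector bundles of class `C^n` over the identity of `M`. -/
structure BundleHom where
  toFun : ∀ x : M, E₁ x →ₗ[𝕜] E₂ x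
  contMDiff : ContMDiff (𝓘(𝕜, B).prod 𝓘(𝕜, F₁)) (𝓘(𝕜, B).prod 𝓘(𝕜, F₂)) n
    (fun p : TotalSpace F₁ E₁ => TotalSpace.mk' F₂ p.1 (toFun p.1 p.2))

variable {𝕜 B n F₁ E₁ F₂ E₂}

/-- The map `Γ_U(E₁) → Γ_U(E₂)` induced by a morphism of vector bundles. -/
def BundleHom.onSec (d : BundleHom 𝕜 B n F₁ E₁ F₂ E₂) (U : Opens M) :
    Sec 𝕜 B n F₁ E₁ U →ₗ[𝕜] Sec 𝕜 B n F₂ E₂ U where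
  toFun s := ⟨fun x => d.toFun x (s.1 x),
    ⟨d.contMDiff.comp_contMDiffOn s.2.1, fun x hx => by simp [s.2.2 x hx]⟩⟩
  map_add' s t := by ext x; simp
  map_smul' c s := by ext x; simp

/-- The points having a neighbourhood on which `d` has constant rank. -/
def BundleHom.regularSet (d : BundleHom 𝕜 B n F₁ E₁ F₂ E₂) : Set M :=
  {x | ∃ U : Opens M, x ∈ U ∧ ∀ y ∈ U, ∀ z ∈ U,
    Module.finrank 𝕜 (LinearMap.range (d.toFun y)) =
      Module.finrank 𝕜 (LinearMap.range (d.toFun z))}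

variable (𝕜) (F : Type*) [NormedAddCommGroup F] [InnerProductSpace 𝕜 F] [FiniteDimensional 𝕜 F]
  (E : M → Type*) [TopologicalSpace (TotalSpace F E)]
  [∀ x, AddCommGroup (E x)] [∀ x, Module 𝕜 (E x)] [∀ x, TopologicalSpace (E x)]
  [FiberBundle F E] [VectorBundle 𝕜 F E]

/-- The Grassmann bundle `Gr(E) → M`: pairs of a point `x` and a linear subspace of `E x`. It is
the disjoint union, over all `q`, of the bundles of subspaces of codimension `q`. -/
structure Gr (_F : Type*) (E : M → Type*) [∀ x, AddCommGroup (E x)] [∀ x, Module 𝕜 (E x)] where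
  base : M
  space : Submodule 𝕜 (E base)

/-- The local trivialization of `Gr(E)` given by the preferred trivialization of `E` at `x₀`:
it sends `(x, V)` to the pair of `x` and the orthogonal projection of the model fibre `F` onto the
image of `V`. A subspace of `F` is thus encoded by its orthogonal projection, and the gap metric
on the Grassmannian of `F` is the distance of the projections in operator norm. -/
def Gr.chart (x₀ : M) (p : Gr 𝕜 F E) : M × (F →L[𝕜] F) :=
  (p.base, (p.space.map ((trivializationAt F E x₀).linearMapAt 𝕜 p.base)).starProjection)

/-- The topology of the Grassmann bundle: it is generated by the sets that are open in one of the
local trivializations `Gr(E)|_W ≃ W × Gr(F)`. -/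
instance Gr.topology : TopologicalSpace (Gr 𝕜 F E) :=
  generateFrom {S | ∃ (x₀ : M) (O : Set (M × (F →L[𝕜] F))), IsOpen O ∧
    S = {p | p.base ∈ (trivializationAt F E x₀).baseSet ∧ Gr.chart 𝕜 F E x₀ p ∈ O}}

variable {𝕜 F E}

/-- The Nash blowup of `M` along `d`: the closure in the Grassmann bundle of the set of all images
`im d_x` at the regular points `x` of `d`. -/
def BundleHom.nashBlowup (d : BundleHom 𝕜 B n F₁ E₁ F E) : Set (Gr 𝕜 F E) :=
  closure {p | ∃ x ∈ d.regularSet, p = ⟨x, LinearMap.range (d.toFun x)⟩}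

end Nash

/-! ## Singular foliations -/

section Foliations

variable (𝕜 : Type*) [RCLike 𝕜] (B : Type*) [NormedAddCommGroup B] [NormedSpace 𝕜 B]
  (n : WithTop ℕ∞) (M : Type*) [TopologicalSpace M] [ChartedSpace B M]
  [IsManifold 𝓘(𝕜, B) 1 M]

/-- A singular foliation: a subsheaf of modules of the sheaf of vector fields that is stable under
the Lie bracket and locally finitely generated. -/
structure SingularFoliation where
  /-- The module of sections over each open set. -/
  sections : Opens M → Submodule 𝕜 (∀ x : M, TangentSpace 𝓘(𝕜, B) x)
  isSec : ∀ U, sections U ≤ Sec 𝕜 B n B (TangentSpace 𝓘(𝕜, B) : M → Type _) U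
  smul_mem : ∀ (U : Opens M) (f : M → 𝕜), IsFun 𝕜 B n U f → ∀ X ∈ sections U,
    (fun x => f x • X x) ∈ sections U
  restr_mem : ∀ U V : Opens M, V ≤ U → ∀ X ∈ sections U, restr V X ∈ sections V
  glue : ∀ (U : Opens M), ∀ X ∈ Sec 𝕜 B n B (TangentSpace 𝓘(𝕜, B) : M → Type _) U,
    (∀ x ∈ U, ∃ V ≤ U, x ∈ V ∧ restr V X ∈ sections V) → X ∈ sections U
  lie_mem : ∀ (U : Opens M), ∀ X ∈ sections U, ∀ Y ∈ sections U,
    restr U (VectorField.mlieBracket 𝓘(𝕜, B) X Y) ∈ sections U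
  /-- Generation is meant as generation of a sheaf of modules, that is, locally. -/
  locallyFG : ∀ x : M, ∃ U : Opens M, x ∈ U ∧
    ∃ (k : ℕ) (X : Fin k → ∀ y : M, TangentSpace 𝓘(𝕜, B) y), (∀ i, X i ∈ sections U) ∧
      ∀ V ≤ U, ∀ Y ∈ sections V, ∀ y ∈ V, ∃ W ≤ V, y ∈ W ∧
        ∃ f : Fin k → M → 𝕜, (∀ i, IsFun 𝕜 B n W (f i)) ∧
          ∀ z ∈ W, Y z = ∑ i, f i z • X i z

end Foliations

/-! ## Geometric resolutions and Lie ∞-algebroids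

The vector bundle `E i`, `i : ℕ`, sits in degree `-(i + 1)`. -/

section Algebroids

variable (𝕜 : Type*) [RCLike 𝕜] (B : Type*) [NormedAddCommGroup B] [NormedSpace 𝕜 B]
  (n : WithTop ℕ∞) {M : Type*} [TopologicalSpace M] [ChartedSpace B M]
  [IsManifold 𝓘(𝕜, B) 1 M]
  (F : ℕ → Type*) [∀ i, NormedAddCommGroup (F i)] [∀ i, InnerProductSpace 𝕜 (F i)]
  [∀ i, FiniteDimensional 𝕜 (F i)]
  (E : ℕ → M → Type*) [∀ i, TopologicalSpace (TotalSpace (F i) (E i))]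
  [∀ i x, AddCommGroup (E i x)] [∀ i x, Module 𝕜 (E i x)] [∀ i x, TopologicalSpace (E i x)]
  [∀ i, FiberBundle (F i) (E i)] [∀ i, VectorBundle 𝕜 (F i) (E i)]

variable {𝕜 B n} in
/-- A geometric resolution of `𝔉`: a complex of vector bundles
`⋯ → E 2 → E 1 → E 0 → TM` that is exact on the level of sheaves of sections, and such that the
image sheaf of the last map is `𝔉`. -/
structure GeometricResolution (𝔉 : SingularFoliation 𝕜 B n M) where
  anchor : BundleHom 𝕜 B n (F 0) (E 0) B (TangentSpace 𝓘(𝕜, B) : M → Type _)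
  d : ∀ i, BundleHom 𝕜 B n (F (i + 1)) (E (i + 1)) (F i) (E i)
  anchor_d : ∀ x v, anchor.toFun x ((d 0).toFun x v) = 0
  d_d : ∀ i x v, (d i).toFun x ((d (i + 1)).toFun x v) = 0
  anchor_mem : ∀ (U : Opens M) (s : Sec 𝕜 B n (F 0) (E 0) U),
    (anchor.onSec U s).1 ∈ 𝔉.sections U
  exact_foliation : ∀ (U : Opens M), ∀ X ∈ 𝔉.sections U, ∀ x ∈ U, ∃ V ≤ U, x ∈ V ∧
    ∃ t : Sec 𝕜 B n (F 0) (E 0) V, (anchor.onSec V t).1 = restr V X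
  exact_zero : ∀ (U : Opens M) (s : Sec 𝕜 B n (F 0) (E 0) U), anchor.onSec U s = 0 →
    ∀ x ∈ U, ∃ (V : Opens M) (h : V ≤ U), x ∈ V ∧
      ∃ t : Sec 𝕜 B n (F 1) (E 1) V, (d 0).onSec V t = Sec.res 𝕜 B n (F 0) (E 0) h s
  exact_succ : ∀ (i : ℕ) (U : Opens M) (s : Sec 𝕜 B n (F (i + 1)) (E (i + 1)) U),
    (d i).onSec U s = 0 → ∀ x ∈ U, ∃ (V : Opens M) (h : V ≤ U), x ∈ V ∧
      ∃ t : Sec 𝕜 B n (F (i + 2)) (E (i + 2)) V,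
        (d (i + 1)).onSec V t = Sec.res 𝕜 B n (F (i + 1)) (E (i + 1)) h s

/-- The sections over `U` of the graded vector bundle `⨁ E i`. -/
abbrev GSec (U : Opens M) : Type _ := ⨁ i : ℕ, Sec 𝕜 B n (F i) (E i) U

variable {F E} in
/-- A section of `E i`, as a homogeneous element of degree `-(i + 1)`. -/
abbrev homog {U : Opens M} (i : ℕ) (s : Sec 𝕜 B n (F i) (E i) U) : GSec 𝕜 B n F E U :=
  DirectSum.lof 𝕜 ℕ (fun i => Sec 𝕜 B n (F i) (E i) U) i s

variable {𝕜 B n} in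
/-- Multiplication of sections of the graded bundle by a function. -/
def GSec.mul {U : Opens M} (f : M → 𝕜) (hf : IsFun 𝕜 B n U f) :
    GSec 𝕜 B n F E U →ₗ[𝕜] GSec 𝕜 B n F E U :=
  DirectSum.lmap fun i => Sec.mul (F i) (E i) f hf

/-- Restriction of sections of the graded bundle. -/
def GSec.res {U V : Opens M} (h : V ≤ U) : GSec 𝕜 B n F E U →ₗ[𝕜] GSec 𝕜 B n F E V :=
  DirectSum.lmap fun i => Sec.res 𝕜 B n (F i) (E i) h

/-- The Koszul sign of the permutation `σ` of elements of degrees `-(a j + 1)`: the product of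
`(-1)^(|x||y|)` over all pairs of elements `x`, `y` whose order is reversed. -/
def koszulSign {k : ℕ} (a : Fin k → ℕ) (σ : Equiv.Perm (Fin k)) : ℤ :=
  ∏ p, ∏ q, if p < q ∧ σ q < σ p then (-1) ^ ((a (σ p) + 1) * (a (σ q) + 1)) else 1

/-- The Koszul sign of the unshuffle that moves the elements with index in `S` to the front. -/
def unshuffleSign {k : ℕ} (a : Fin k → ℕ) (S : Finset (Fin k)) : ℤ :=
  ∏ p ∈ Sᶜ, ∏ q ∈ S, if p < q then (-1) ^ ((a p + 1) * (a q + 1)) else 1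

/-- A Lie ∞-algebroid structure on the graded vector bundle `E`: an anchor and a Lie ∞-algebra
structure, with graded symmetric brackets of degree `+1`, on the sheaf of sections of `E`, such
that the brackets are multilinear over functions, except for the Leibniz rule of the binary
bracket in entries from `E 0`. -/
structure LieInftyAlgebroid where
  anchor : BundleHom 𝕜 B n (F 0) (E 0) B (TangentSpace 𝓘(𝕜, B) : M → Type _)
  /-- The `k`-ary bracket on sections over `U`. -/
  bracket : ∀ (U : Opens M) (k : ℕ),
    MultilinearMap 𝕜 (fun _ : Fin k => GSec 𝕜 B n F E U) (GSec 𝕜 B n F E U)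
  /-- There is no `0`-ary bracket. -/
  bracket_zero : ∀ U, bracket U 0 = 0
  /-- The brackets are morphisms of sheaves. -/
  bracket_res : ∀ (U V : Opens M) (h : V ≤ U) (k : ℕ) (x : Fin k → GSec 𝕜 B n F E U),
    bracket V k (fun j => GSec.res 𝕜 B n F E h (x j)) = GSec.res 𝕜 B n F E h (bracket U k x)
  /-- The brackets have degree `+1`. -/
  bracket_degree : ∀ (U : Opens M) (k : ℕ) (a : Fin k → ℕ)
    (s : ∀ j, Sec 𝕜 B n (F (a j)) (E (a j)) U) (m : ℕ),
    -((m : ℤ) + 1) ≠ (∑ j, -((a j : ℤ) + 1)) + 1 →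
      bracket U k (fun j => homog 𝕜 B n (a j) (s j)) m = 0
  /-- The brackets are graded symmetric. -/
  bracket_symm : ∀ (U : Opens M) (k : ℕ) (a : Fin k → ℕ)
    (s : ∀ j, Sec 𝕜 B n (F (a j)) (E (a j)) U) (σ : Equiv.Perm (Fin k)),
    bracket U k (fun j => homog 𝕜 B n (a (σ j)) (s (σ j))) =
      koszulSign a σ • bracket U k (fun j => homog 𝕜 B n (a j) (s j))
  /-- The higher Jacobi identities. -/
  jacobi : ∀ (U : Opens M) (k : ℕ) (a : Fin k → ℕ)
    (s : ∀ j, Sec 𝕜 B n (F (a j)) (E (a j)) U) (x : Fin k → GSec 𝕜 B n F E U),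
    (∀ j, x j = homog 𝕜 B n (a j) (s j)) →
    ∑ S : Finset (Fin k), unshuffleSign a S •
      bracket U (Sᶜ.card + 1) (Fin.cons
        (bracket U S.card (fun j => x (S.orderEmbOfFin rfl j)))
        (fun j => x (Sᶜ.orderEmbOfFin rfl j))) = 0
  /-- The `k`-ary brackets with `k ≠ 2` are multilinear over functions. -/
  bracket_smul : ∀ (U : Opens M) (k : ℕ), k ≠ 2 → ∀ (f : M → 𝕜) (hf : IsFun 𝕜 B n U f)
    (x : Fin k → GSec 𝕜 B n F E U) (j : Fin k),
    bracket U k (Function.update x j (GSec.mul F E f hf (x j))) =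
      GSec.mul F E f hf (bracket U k x)
  /-- The Leibniz rule for `e ∈ Γ_U(E 0)`. -/
  leibniz : ∀ (U : Opens M) (f : M → 𝕜) (hf : IsFun 𝕜 B n U f)
    (e : Sec 𝕜 B n (F 0) (E 0) U) (i : ℕ) (y : Sec 𝕜 B n (F i) (E i) U), ∀ x ∈ U,
    (bracket U 2 ![homog 𝕜 B n 0 e, homog 𝕜 B n i (Sec.mul (F i) (E i) f hf y)] i).1 x =
      dirDeriv 𝕜 B f x (anchor.toFun x (e.1 x)) • y.1 x +
        f x • (bracket U 2 ![homog 𝕜 B n 0 e, homog 𝕜 B n i y] i).1 x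
  /-- The binary bracket with an element of degree at most `-2` is linear over functions. -/
  bracket_two_smul : ∀ (U : Opens M) (f : M → 𝕜) (hf : IsFun 𝕜 B n U f)
    (i : ℕ) (e : Sec 𝕜 B n (F (i + 1)) (E (i + 1)) U) (y : GSec 𝕜 B n F E U),
    bracket U 2 ![homog 𝕜 B n (i + 1) e, GSec.mul F E f hf y] =
      GSec.mul F E f hf (bracket U 2 ![homog 𝕜 B n (i + 1) e, y])

variable {𝕜 B n F E}

/-- The Lie ∞-algebroid `L` is built on the geometric resolution `R` of `𝔉`: its anchor and its
unary bracket are those of `R`. This says that `L` is a universal Lie ∞-algebroid of `𝔉`. -/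
structure LieInftyAlgebroid.IsUniversal {𝔉 : SingularFoliation 𝕜 B n M}
    (L : LieInftyAlgebroid 𝕜 B n F E) (R : GeometricResolution F E 𝔉) : Prop where
  anchor_eq : L.anchor = R.anchor
  unary_eq : ∀ (U : Opens M) (i : ℕ) (s : Sec 𝕜 B n (F (i + 1)) (E (i + 1)) U),
    L.bracket U 1 ![homog 𝕜 B n (i + 1) s] = homog 𝕜 B n i ((R.d i).onSec U s)

/-- `w` is a value at `x` of the binary bracket of local sections with values `u` and `v` at `x`.
The bracket `{u, v}₂`, when it is defined, is the unique such `w`. -/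
def LieInftyAlgebroid.IsBracketAt (L : LieInftyAlgebroid 𝕜 B n F E) (x : M) {i j : ℕ}
    (u : E i x) (v : E j x) (w : E (i + j) x) : Prop :=
  ∃ (U : Opens M) (_ : x ∈ U) (s : Sec 𝕜 B n (F i) (E i) U) (t : Sec 𝕜 B n (F j) (E j) U),
    s.1 x = u ∧ t.1 x = v ∧
      (L.bracket U 2 ![homog 𝕜 B n i s, homog 𝕜 B n j t] (i + j)).1 x = w

variable (𝕜 F E) in
/-- The fibre product over `M` of the Grassmann bundles of all `E i`. -/
structure GrProd (_F : ℕ → Type*) (E : ℕ → M → Type*) [∀ i x, AddCommGroup (E i x)]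
    [∀ i x, Module 𝕜 (E i x)] where
  base : M
  space : ∀ i, Submodule 𝕜 (E i base)

/-- The topology of the fibre product, as a subspace of the product of all Grassmann bundles. -/
instance GrProd.topology : TopologicalSpace (GrProd 𝕜 F E) :=
  TopologicalSpace.induced
    (fun (p : GrProd 𝕜 F E) (i : ℕ) => (⟨p.base, p.space i⟩ : Gr 𝕜 (F i) (E i)))
    Pi.topologicalSpace

/-- The last blowup space of the resolution `R`: the closure of the set of the families
`(im d_x : E (i + 1) → E i)_i` at the regular points `x` of the foliation. -/
def GeometricResolution.lastBlowup {𝔉 : SingularFoliation 𝕜 B n M}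
    (R : GeometricResolution F E 𝔉) : Set (GrProd 𝕜 F E) :=
  closure {p | ∃ x ∈ R.anchor.regularSet,
    p = ⟨x, fun i => LinearMap.range ((R.d i).toFun x)⟩}

end Algebroids

end

/-! ### Local frames: sections that are constant in a trivialization. -/

section Sections

variable {𝕜 : Type*} [RCLike 𝕜] {B : Type*} [NormedAddCommGroup B] [NormedSpace 𝕜 B]
  {M : Type*} [TopologicalSpace M] [ChartedSpace B M] {n : WithTop ℕ∞}
  {F : Type*} [NormedAddCommGroup F] [NormedSpace 𝕜 F]
  {E : M → Type*} [TopologicalSpace (TotalSpace F E)]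
  [∀ x, AddCommGroup (E x)] [∀ x, Module 𝕜 (E x)] [∀ x, TopologicalSpace (E x)]
  [FiberBundle F E] [VectorBundle 𝕜 F E]

/-! At each point `y` the images of `d` are already closed under the binary bracket. Values in the
kernel of the anchor kill the derivative term of the Leibniz rule, so the bracket at `y` depends
only on the values of its entries at `y` (`binary_congr`). Entries in the images of `d` may
therefore be replaced by exact sections `dσ`, `dτ`. As `dτ` is closed, the Jacobi identity for `σ`
and `dτ` reads `{dσ, dτ} = -d{σ, dτ}`, which is again in the image of `d` (`binary_d_mem`,
`binary_mem_range`).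

It remains to pass to the limit. A point of the closure is a limit of images along a filter on `M`.
With subspaces encoded by orthogonal projections, every element of the limit is a limit of elements
of the images (`Gr.exists_tendsto_of_mem`), and conversely a limit of such elements lies in the
limit space (`Gr.mem_of_tendsto`). Extended by sections constant in a trivialization, these elements
have brackets that converge, because the bracket of constant sections is continuous in the point and
bilinear in finitely many parameters. The inclusion in the kernel of the anchor follows in the same
way from `ρ ∘ d = 0`. -/

theorem restr_of_mem {U : Opens M} (s : ∀ x, E x) {x : M} (hx : x ∈ U) : restr U s x = s x :=
  if_pos hx

theorem Sec.res_apply {U V : Opens M} (h : V ≤ U) (s : Sec 𝕜 B n F E U) {x : M} (hx : x ∈ V) :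
    (Sec.res 𝕜 B n F E h s).1 x = s.1 x :=
  if_pos hx

variable (F E) in
/-- The open domain of the preferred trivialization at `x₀`. -/
def trivDomain (x₀ : M) : Opens M :=
  ⟨(trivializationAt F E x₀).baseSet, (trivializationAt F E x₀).open_baseSet⟩

theorem mem_trivDomain (x₀ : M) : x₀ ∈ trivDomain F E x₀ :=
  FiberBundle.mem_baseSet_trivializationAt' x₀

theorem Sec.contMDiffOn_linearMapAt [ContMDiffVectorBundle n F E 𝓘(𝕜, B)] (x₀ : M) {U : Opens M}
    (hU : U ≤ trivDomain F E x₀) (s : Sec 𝕜 B n F E U) :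
    ContMDiffOn 𝓘(𝕜, B) 𝓘(𝕜, F) n
      (fun y => (trivializationAt F E x₀).linearMapAt 𝕜 y (s.1 y)) U :=
  (((trivializationAt F E x₀).contMDiffOn_section_iff U.isOpen hU).1 s.2.1).congr fun y hy => by
    rw [Trivialization.coe_linearMapAt_of_mem _ (hU hy)]

/-- The sections over `U` that are constant in the preferred trivialization at `x₀`. -/
noncomputable def Sec.const [ContMDiffVectorBundle n F E 𝓘(𝕜, B)] (x₀ : M) {U : Opens M}
    (hU : U ≤ trivDomain F E x₀) : F →ₗ[𝕜] Sec 𝕜 B n F E U where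
  toFun f := ⟨restr U fun y => (trivializationAt F E x₀).symmₗ 𝕜 y f, by
    refine ⟨?_, fun x hx => if_neg hx⟩
    refine ((trivializationAt F E x₀).contMDiffOn_section_iff U.isOpen hU).2 ?_
    refine (contMDiffOn_const (c := f)).congr fun y hy => ?_
    have h := (trivializationAt F E x₀).linearMapAt_symmₗ (R := 𝕜) (hU hy) f
    rw [Trivialization.coe_linearMapAt_of_mem _ (hU hy)] at h
    rw [restr_of_mem _ hy]
    exact h⟩
  map_add' f g := by
    ext x
    by_cases hx : x ∈ U <;> simp [restr, hx]
  map_smul' c f := by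
    ext x
    by_cases hx : x ∈ U <;> simp [restr, hx]

section Const

variable [ContMDiffVectorBundle n F E 𝓘(𝕜, B)] (x₀ : M) {U : Opens M}
  (hU : U ≤ trivDomain F E x₀)

theorem Sec.const_apply (f : F) {y : M} (hy : y ∈ U) :
    (Sec.const (𝕜 := 𝕜) (B := B) (n := n) x₀ hU f).1 y =
      (trivializationAt F E x₀).symmₗ 𝕜 y f :=
  if_pos hy

theorem Sec.const_linearMapAt {y : M} (hy : y ∈ U) (u : E y) :
    (Sec.const (𝕜 := 𝕜) (B := B) (n := n) x₀ hU
      ((trivializationAt F E x₀).linearMapAt 𝕜 y u)).1 y = u := by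
  rw [Sec.const_apply x₀ hU _ hy]
  exact (trivializationAt F E x₀).symmₗ_linearMapAt (hU hy) u

theorem Sec.isFun_coord [FiniteDimensional 𝕜 F] {U : Opens M} (hU : U ≤ trivDomain F E x₀) (s : Sec 𝕜 B n F E U) {ι : Type*}
    (b : Module.Basis ι 𝕜 F) (a : ι) :
    IsFun 𝕜 B n U fun y => b.coord a ((trivializationAt F E x₀).linearMapAt 𝕜 y (s.1 y)) :=
  ((b.coord a).toContinuousLinearMap.contMDiff).comp_contMDiffOn
    (Sec.contMDiffOn_linearMapAt x₀ hU s)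

/-- The constant sections attached to a basis of the model fibre form a frame. A section vanishing
at a point thus has coefficient functions that vanish there, which turns linearity over functions
into dependence on values only. -/
theorem Sec.eq_sum_mul_const [FiniteDimensional 𝕜 F] (s : Sec 𝕜 B n F E U) {ι : Type*} [Fintype ι]
    (b : Module.Basis ι 𝕜 F) :
    s = ∑ a, Sec.mul F E _ (Sec.isFun_coord x₀ hU s b a) (Sec.const x₀ hU (b a)) := by
  ext y
  rw [AddSubmonoidClass.coe_finsetSum, Finset.sum_apply]
  by_cases hy : y ∈ U
  · conv_lhs => rw [← Sec.const_linearMapAt (𝕜 := 𝕜) (B := B) (n := n) x₀ hU hy (s.1 y),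
      Sec.const_apply x₀ hU _ hy,
      ← b.sum_repr ((trivializationAt F E x₀).linearMapAt 𝕜 y (s.1 y)), map_sum]
    refine Finset.sum_congr rfl fun a _ => ?_
    rw [map_smul, ← Sec.const_apply (B := B) (n := n) x₀ hU (b a) hy]
    rfl
  · rw [s.2.2 y hy, Finset.sum_eq_zero]
    intro a _
    exact (Sec.mul F E _ (Sec.isFun_coord x₀ hU s b a) (Sec.const x₀ hU (b a))).2.2 y hy

end Const

end Sections

theorem update_pair_zero {α : Type*} (a b c : α) : Function.update ![a, b] 0 c = ![c, b] := by
  funext k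
  fin_cases k <;> rfl

theorem update_pair_one {α : Type*} (a b c : α) : Function.update ![a, b] 1 c = ![a, c] := by
  funext k
  fin_cases k <;> rfl

/-! ### The binary bracket at a point depends only on values killed by the anchor. -/

section Algebroids

variable {𝕜 : Type*} [RCLike 𝕜] {B : Type*} [NormedAddCommGroup B] [NormedSpace 𝕜 B]
  {n : WithTop ℕ∞} {M : Type*} [TopologicalSpace M] [ChartedSpace B M]
  [IsManifold 𝓘(𝕜, B) 1 M]
  {F : ℕ → Type*} [∀ i, NormedAddCommGroup (F i)] [∀ i, InnerProductSpace 𝕜 (F i)]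
  [∀ i, FiniteDimensional 𝕜 (F i)]
  {E : ℕ → M → Type*} [∀ i, TopologicalSpace (TotalSpace (F i) (E i))]
  [∀ i x, AddCommGroup (E i x)] [∀ i x, Module 𝕜 (E i x)] [∀ i x, TopologicalSpace (E i x)]
  [∀ i, FiberBundle (F i) (E i)] [∀ i, VectorBundle 𝕜 (F i) (E i)]

theorem GSec.mul_homog {U : Opens M} (f : M → 𝕜) (hf : IsFun 𝕜 B n U f) (i : ℕ)
    (s : Sec 𝕜 B n (F i) (E i) U) :
    GSec.mul F E f hf (homog 𝕜 B n i s) = homog 𝕜 B n i (Sec.mul (F i) (E i) f hf s) :=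
  DirectSum.lmap_lof _ _ _

theorem GSec.res_homog {U V : Opens M} (h : V ≤ U) (i : ℕ) (s : Sec 𝕜 B n (F i) (E i) U) :
    GSec.res 𝕜 B n F E h (homog 𝕜 B n i s) =
      homog 𝕜 B n i (Sec.res 𝕜 B n (F i) (E i) h s) :=
  DirectSum.lmap_lof _ _ _

theorem GSec.res_apply {U V : Opens M} (h : V ≤ U) (z : GSec 𝕜 B n F E U) (m : ℕ) :
    GSec.res 𝕜 B n F E h z m = Sec.res 𝕜 B n (F m) (E m) h (z m) :=
  DirectSum.lmap_apply _ _ _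

theorem GSec.mul_apply {U : Opens M} (f : M → 𝕜) (hf : IsFun 𝕜 B n U f)
    (z : GSec 𝕜 B n F E U) (m : ℕ) :
    GSec.mul F E f hf z m = Sec.mul (F m) (E m) f hf (z m) :=
  DirectSum.lmap_apply _ _ _

namespace LieInftyAlgebroid

variable (L : LieInftyAlgebroid 𝕜 B n F E)

/-- The binary bracket of homogeneous sections, as a bilinear map. -/
noncomputable def binary (U : Opens M) (i j : ℕ) : Sec 𝕜 B n (F i) (E i) U →ₗ[𝕜]
    Sec 𝕜 B n (F j) (E j) U →ₗ[𝕜] GSec 𝕜 B n F E U :=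
  LinearMap.mk₂ 𝕜 (fun s t => L.bracket U 2 ![homog 𝕜 B n i s, homog 𝕜 B n j t])
    (fun s s' t => by
      have h := (L.bracket U 2).map_update_add ![0, homog 𝕜 B n j t] 0 (homog 𝕜 B n i s)
        (homog 𝕜 B n i s')
      simp only [update_pair_zero] at h
      exact (congrArg (fun z => L.bracket U 2 ![z, _]) (map_add _ s s')).trans h)
    (fun c s t => by
      have h := (L.bracket U 2).map_update_smul ![0, homog 𝕜 B n j t] 0 c (homog 𝕜 B n i s)
      simp only [update_pair_zero] at h
      exact (congrArg (fun z => L.bracket U 2 ![z, _]) (map_smul _ c s)).trans h)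
    (fun s t t' => by
      have h := (L.bracket U 2).map_update_add ![homog 𝕜 B n i s, 0] 1 (homog 𝕜 B n j t)
        (homog 𝕜 B n j t')
      simp only [update_pair_one] at h
      exact (congrArg (fun z => L.bracket U 2 ![_, z]) (map_add _ t t')).trans h)
    (fun c s t => by
      have h := (L.bracket U 2).map_update_smul ![homog 𝕜 B n i s, 0] 1 c (homog 𝕜 B n j t)
      simp only [update_pair_one] at h
      exact (congrArg (fun z => L.bracket U 2 ![_, z]) (map_smul _ c t)).trans h)

theorem binary_apply {U : Opens M} {i j : ℕ} (s : Sec 𝕜 B n (F i) (E i) U)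
    (t : Sec 𝕜 B n (F j) (E j) U) :
    L.binary U i j s t = L.bracket U 2 ![homog 𝕜 B n i s, homog 𝕜 B n j t] :=
  rfl

theorem binary_res {U V : Opens M} (h : V ≤ U) {i j : ℕ} (s : Sec 𝕜 B n (F i) (E i) U)
    (t : Sec 𝕜 B n (F j) (E j) U) :
    L.binary V i j (Sec.res 𝕜 B n (F i) (E i) h s) (Sec.res 𝕜 B n (F j) (E j) h t) =
      GSec.res 𝕜 B n F E h (L.binary U i j s t) := by
  rw [binary_apply, binary_apply, ← L.bracket_res U V h 2]
  congr 1
  funext k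
  fin_cases k
  · exact (GSec.res_homog h i s).symm
  · exact (GSec.res_homog h j t).symm

theorem binary_res_apply {U V : Opens M} (h : V ≤ U) {i j : ℕ} (s : Sec 𝕜 B n (F i) (E i) U)
    (t : Sec 𝕜 B n (F j) (E j) U) (m : ℕ) {x : M} (hx : x ∈ V) :
    (L.binary V i j (Sec.res 𝕜 B n (F i) (E i) h s) (Sec.res 𝕜 B n (F j) (E j) h t) m).1 x =
      (L.binary U i j s t m).1 x := by
  rw [binary_res, GSec.res_apply, Sec.res_apply h _ hx]

theorem binary_degree {U : Opens M} {i j : ℕ} (s : Sec 𝕜 B n (F i) (E i) U)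
    (t : Sec 𝕜 B n (F j) (E j) U) {m : ℕ} (hm : m ≠ i + j) : L.binary U i j s t m = 0 := by
  -- The pair of sections is a dependent family, hence nested `Fin.cons` in place of `![s, t]`.
  have h := L.bracket_degree U 2 ![i, j] (Fin.cons s (Fin.cons t fun k => k.elim0)) m (by
    simp [Fin.sum_univ_two]
    omega)
  rw [binary_apply, ← h]
  congr 2
  ext k
  fin_cases k <;> rfl

/-- The sign may stay anonymous: symmetry only serves to carry vanishing from one slot to the other.
-/
theorem binary_symm {U : Opens M} {i j : ℕ} (s : Sec 𝕜 B n (F i) (E i) U)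
    (t : Sec 𝕜 B n (F j) (E j) U) : ∃ ε : ℤ, L.binary U i j s t = ε • L.binary U j i t s := by
  have h := L.bracket_symm U 2 ![j, i] (Fin.cons t (Fin.cons s fun k => k.elim0))
    (Equiv.swap 0 1)
  refine ⟨koszulSign ![j, i] (Equiv.swap 0 1), ?_⟩
  rw [binary_apply, binary_apply]
  convert h using 2
  · ext k
    fin_cases k <;> rfl
  · congr 1
    ext k
    fin_cases k <;> rfl

/-- The element `u` of `E i` at `x` is killed by the anchor; there is no condition if `i > 0`. -/
def AnchorKills (x : M) : ∀ i : ℕ, E i x → Prop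
  | 0, u => L.anchor.toFun x u = 0
  | _ + 1, _ => True

/-- The only obstruction to linearity over functions is the derivative of `f` along the anchor of
`t`, and this vector vanishes at `x`. -/
theorem binary_mul_right {x : M} {U : Opens M} (hx : x ∈ U) {i j : ℕ}
    (t : Sec 𝕜 B n (F j) (E j) U) (ht : L.AnchorKills x j (t.1 x)) (f : M → 𝕜)
    (hf : IsFun 𝕜 B n U f) (s : Sec 𝕜 B n (F i) (E i) U) (m : ℕ) :
    (L.binary U j i t (Sec.mul (F i) (E i) f hf s) m).1 x = f x • (L.binary U j i t s m).1 x := by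
  cases j with
  | zero =>
    by_cases hm : m = i
    · subst hm
      have h := L.leibniz U f hf t m s x hx
      have ht' : L.anchor.toFun x (t.1 x) = 0 := ht
      rw [ht', dirDeriv, map_zero] at h
      rw [binary_apply, h]
      -- The zero scalar is typed in a tangent space of `𝕜`, which is `𝕜` only by unfolding.
      erw [zero_smul, zero_add]
      rfl
    · rw [L.binary_degree _ _ (by omega), L.binary_degree _ _ (by omega)]
      simp
  | succ j =>
    have h := L.bracket_two_smul U f hf j t (homog 𝕜 B n i s)
    rw [GSec.mul_homog] at h
    rw [binary_apply, h, GSec.mul_apply]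
    rfl

variable [∀ i, ContMDiffVectorBundle n (F i) (E i) 𝓘(𝕜, B)]

/-- Near `x`, expand `s` in a constant frame: each coefficient comes out of the bracket evaluated at
`x`, where it is zero. -/
theorem binary_right_eq_zero {x : M} {U : Opens M} (hx : x ∈ U) {i j : ℕ}
    (t : Sec 𝕜 B n (F j) (E j) U) (ht : L.AnchorKills x j (t.1 x))
    (s : Sec 𝕜 B n (F i) (E i) U) (hs : s.1 x = 0) (m : ℕ) :
    (L.binary U j i t s m).1 x = 0 := by
  set V := U ⊓ trivDomain (F i) (E i) x
  have hV : x ∈ V := ⟨hx, mem_trivDomain x⟩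
  have hVU : V ≤ U := inf_le_left
  rw [← L.binary_res_apply hVU t s m hV]
  set t' := Sec.res 𝕜 B n (F j) (E j) hVU t
  set s' := Sec.res 𝕜 B n (F i) (E i) hVU s
  have ht' : L.AnchorKills x j (t'.1 x) := by rwa [Sec.res_apply hVU t hV]
  have hs' : s'.1 x = 0 := by rwa [Sec.res_apply hVU s hV]
  rw [Sec.eq_sum_mul_const x inf_le_right s' (Module.finBasis 𝕜 (F i)), map_sum,
    DFinsupp.finsetSum_apply,
    AddSubmonoidClass.coe_finsetSum, Finset.sum_apply]
  refine Finset.sum_eq_zero fun a _ => ?_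
  rw [L.binary_mul_right hV t' ht', hs', map_zero, map_zero, zero_smul]

theorem binary_left_eq_zero {x : M} {U : Opens M} (hx : x ∈ U) {i j : ℕ}
    (t : Sec 𝕜 B n (F j) (E j) U) (ht : L.AnchorKills x j (t.1 x))
    (s : Sec 𝕜 B n (F i) (E i) U) (hs : s.1 x = 0) (m : ℕ) :
    (L.binary U i j s t m).1 x = 0 := by
  obtain ⟨ε, h⟩ := L.binary_symm s t
  have h' : (L.binary U i j s t m).1 x = ε • (L.binary U j i t s m).1 x := by
    rw [h]
    rfl
  rw [h', L.binary_right_eq_zero hx t ht s hs, smul_zero]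

/-- On elements killed by the anchor, the binary bracket only depends on the values. -/
theorem binary_congr {x : M} {i j : ℕ} {U U' : Opens M} (hx : x ∈ U) (hx' : x ∈ U')
    (s : Sec 𝕜 B n (F i) (E i) U) (t : Sec 𝕜 B n (F j) (E j) U)
    (s' : Sec 𝕜 B n (F i) (E i) U') (t' : Sec 𝕜 B n (F j) (E j) U')
    (hs : s.1 x = s'.1 x) (ht : t.1 x = t'.1 x)
    (ks : L.AnchorKills x i (s.1 x)) (kt : L.AnchorKills x j (t.1 x)) (m : ℕ) :
    (L.binary U i j s t m).1 x = (L.binary U' i j s' t' m).1 x := by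
  have hV : x ∈ U ⊓ U' := ⟨hx, hx'⟩
  have h₁ : U ⊓ U' ≤ U := inf_le_left
  have h₂ : U ⊓ U' ≤ U' := inf_le_right
  rw [← L.binary_res_apply h₁ s t m hV, ← L.binary_res_apply h₂ s' t' m hV]
  have es := Sec.res_apply h₁ s hV
  have et := Sec.res_apply h₁ t hV
  have es' := Sec.res_apply h₂ s' hV
  have et' := Sec.res_apply h₂ t' hV
  set S := Sec.res 𝕜 B n (F i) (E i) h₁ s
  set T := Sec.res 𝕜 B n (F j) (E j) h₁ t
  set S' := Sec.res 𝕜 B n (F i) (E i) h₂ s'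
  set T' := Sec.res 𝕜 B n (F j) (E j) h₂ t'
  -- Decompose `{S, T} = {S - S', T} + {S', T - T'} + {S', T'}`. The first term vanishes at `x`
  -- because `T` is killed by the anchor there, the second because `S'` is.
  have e₁ : (L.binary (U ⊓ U') i j (S - S') T m).1 x = 0 :=
    L.binary_left_eq_zero hV T (by rwa [et]) _ (by
      show S.1 x - S'.1 x = 0
      rw [es, es', hs, sub_self]) m
  have e₂ : (L.binary (U ⊓ U') i j S' (T - T') m).1 x = 0 :=
    L.binary_right_eq_zero hV S' (by rwa [es', ← hs]) _ (by
      show T.1 x - T'.1 x = 0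
      rw [et, et', ht, sub_self]) m
  have a₁ : L.binary (U ⊓ U') i j S T =
      L.binary (U ⊓ U') i j (S - S') T + L.binary (U ⊓ U') i j S' T := by
    rw [← LinearMap.add_apply, ← map_add, sub_add_cancel]
  have a₂ : L.binary (U ⊓ U') i j S' T =
      L.binary (U ⊓ U') i j S' (T - T') + L.binary (U ⊓ U') i j S' T' := by
    rw [← map_add, sub_add_cancel]
  rw [a₁, a₂, DirectSum.add_apply, DirectSum.add_apply]
  exact (congrArg₂ _ e₁ (congrArg₂ _ e₂ rfl)).trans ((zero_add _).trans (zero_add _))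

end LieInftyAlgebroid

end Algebroids

/-! ### The Jacobi identity and brackets of exact sections. -/

section Algebroids

variable {𝕜 : Type*} [RCLike 𝕜] {B : Type*} [NormedAddCommGroup B] [NormedSpace 𝕜 B]
  {n : WithTop ℕ∞} {M : Type*} [TopologicalSpace M] [ChartedSpace B M]
  [IsManifold 𝓘(𝕜, B) 1 M]
  {F : ℕ → Type*} [∀ i, NormedAddCommGroup (F i)] [∀ i, InnerProductSpace 𝕜 (F i)]
  [∀ i, FiniteDimensional 𝕜 (F i)]
  {E : ℕ → M → Type*} [∀ i, TopologicalSpace (TotalSpace (F i) (E i))]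
  [∀ i x, AddCommGroup (E i x)] [∀ i x, Module 𝕜 (E i x)] [∀ i x, TopologicalSpace (E i x)]
  [∀ i, FiberBundle (F i) (E i)] [∀ i, VectorBundle 𝕜 (F i) (E i)]

theorem homog_apply_self {U : Opens M} {i : ℕ} (s : Sec 𝕜 B n (F i) (E i) U) :
    homog 𝕜 B n i s i = s :=
  DirectSum.lof_apply (R := 𝕜) (M := fun i => Sec 𝕜 B n (F i) (E i) U) i s

theorem homog_apply_of_ne {U : Opens M} {i m : ℕ} (s : Sec 𝕜 B n (F i) (E i) U) (hm : m ≠ i) :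
    homog 𝕜 B n i s m = 0 :=
  DFinsupp.single_eq_of_ne (β := fun i => Sec 𝕜 B n (F i) (E i) U) hm

namespace LieInftyAlgebroid

variable (L : LieInftyAlgebroid 𝕜 B n F E)

/-- The Jacobi identity indexes brackets by cardinalities of finsets; this lemma replaces them by
numerals. -/
theorem bracket_eq_of_card {U : Opens M} {k k' : ℕ} (h : k = k') (x : Fin k → GSec 𝕜 B n F E U)
    (x' : Fin k' → GSec 𝕜 B n F E U) (hx : ∀ j, x j = x' (Fin.cast h j)) :
    L.bracket U k x = L.bracket U k' x' := by
  subst h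
  exact congrArg _ (funext hx)

theorem bracket_cons_zero {U : Opens M} {k : ℕ} (x : Fin k → GSec 𝕜 B n F E U) :
    L.bracket U (k + 1) (Fin.cons 0 x) = 0 :=
  (L.bracket U (k + 1)).map_coord_zero 0 (Fin.cons_zero _ _)

/-- The Jacobi identity for two elements the second of which is closed. -/
theorem bracket_unary_left {U : Opens M} {i j : ℕ} (s : Sec 𝕜 B n (F i) (E i) U)
    (t : Sec 𝕜 B n (F j) (E j) U) (ht : L.bracket U 1 ![homog 𝕜 B n j t] = 0) :
    L.bracket U 2 ![L.bracket U 1 ![homog 𝕜 B n i s], homog 𝕜 B n j t] +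
      L.bracket U 1 ![L.binary U i j s t] = 0 := by
  have h := L.jacobi U 2 ![i, j] (Fin.cons s (Fin.cons t fun k => k.elim0))
    ![homog 𝕜 B n i s, homog 𝕜 B n j t] (fun k => by fin_cases k <;> rfl)
  -- Of the four unshuffles, `∅` contributes the zero `0`-ary bracket and `{1}` the bracket of the
  -- closed element. The two others keep the order of the entries and have sign `1`.
  have hu : (Finset.univ : Finset (Finset (Fin 2))) = {∅, {0}, {1}, Finset.univ} := by decide
  rw [hu, Finset.sum_insert (by decide), Finset.sum_insert (by decide),
    Finset.sum_insert (by decide), Finset.sum_singleton] at h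
  have mem (S : Finset (Fin 2)) (k : Fin S.card) : S.orderEmbOfFin rfl k ∈ S :=
    Finset.orderEmbOfFin_mem S rfl k
  have val (S : Finset (Fin 2)) (a : Fin 2) (hS : S = {a}) (k : Fin S.card) :
      S.orderEmbOfFin rfl k = a := by
    subst hS
    exact Finset.mem_singleton.1 (mem _ k)
  have univ_val (k : Fin (Finset.univ : Finset (Fin 2)).card) :
      (Finset.univ : Finset (Fin 2)).orderEmbOfFin rfl k = Fin.cast (by simp) k := by
    rw [← Finset.orderEmbOfFin_unique (s := (Finset.univ : Finset (Fin 2))) rfl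
      (f := Fin.cast (by simp)) (fun _ => Finset.mem_univ _) (fun _ _ h => h)]
  have e₀ : L.bracket U (∅ : Finset (Fin 2)).card (fun k =>
      (![homog 𝕜 B n i s, homog 𝕜 B n j t] : Fin 2 → GSec 𝕜 B n F E U)
        ((∅ : Finset (Fin 2)).orderEmbOfFin rfl k)) = 0 := by
    rw [L.bracket_eq_of_card Finset.card_empty _ (fun k => k.elim0) (fun k => k.elim0),
      L.bracket_zero, zero_apply]
  have e₂ : L.bracket U ({1} : Finset (Fin 2)).card (fun k =>
      (![homog 𝕜 B n i s, homog 𝕜 B n j t] : Fin 2 → GSec 𝕜 B n F E U)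
        (({1} : Finset (Fin 2)).orderEmbOfFin rfl k)) = 0 := by
    rw [L.bracket_eq_of_card (Finset.card_singleton _) _ ![homog 𝕜 B n j t] (fun k => ?_), ht]
    rw [val _ 1 rfl k, Subsingleton.elim (Fin.cast _ k) 0]
    rfl
  have e₁ : L.bracket U ({0} : Finset (Fin 2)).card (fun k =>
      (![homog 𝕜 B n i s, homog 𝕜 B n j t] : Fin 2 → GSec 𝕜 B n F E U)
        (({0} : Finset (Fin 2)).orderEmbOfFin rfl k)) = L.bracket U 1 ![homog 𝕜 B n i s] := by
    refine L.bracket_eq_of_card (Finset.card_singleton _) _ _ (fun k => ?_)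
    rw [val _ 0 rfl k, Subsingleton.elim (Fin.cast _ k) 0]
    rfl
  have e₃ : L.bracket U (Finset.univ : Finset (Fin 2)).card (fun k =>
      (![homog 𝕜 B n i s, homog 𝕜 B n j t] : Fin 2 → GSec 𝕜 B n F E U)
        ((Finset.univ : Finset (Fin 2)).orderEmbOfFin rfl k)) = L.binary U i j s t := by
    refine L.bracket_eq_of_card (Finset.card_fin 2) _ _ (fun k => ?_)
    rw [univ_val]
  have s₁ : unshuffleSign ![i, j] ({0} : Finset (Fin 2)) = 1 := by
    have hc : ({0} : Finset (Fin 2))ᶜ = {1} := by decide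
    simp [unshuffleSign, hc]
  have s₃ : unshuffleSign ![i, j] (Finset.univ : Finset (Fin 2)) = 1 := by
    simp [unshuffleSign]
  rw [e₀, e₁, e₂, e₃, bracket_cons_zero, bracket_cons_zero, smul_zero, smul_zero, zero_add,
    zero_add, s₁, s₃, one_smul, one_smul] at h
  refine Eq.trans ?_ h
  congr 1
  · refine (L.bracket_eq_of_card (by decide) _ _ (fun k => ?_)).symm
    refine Fin.cases ?_ (fun k => ?_) k
    · rfl
    · rw [Fin.cons_succ, val _ 1 (by decide) k]
      have hk : ∀ k : Fin (({0} : Finset (Fin 2))ᶜ).card, ∀ h, Fin.cast h k.succ = (1 : Fin 2) := by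
        decide
      rw [hk]
      rfl
  · refine (L.bracket_eq_of_card (by decide) _ _ (fun k => ?_)).symm
    refine Fin.cases ?_ (fun k => ?_) k
    · rfl
    · exact (Fin.cast (by simp) k : Fin 0).elim0

/-- The unary bracket of `d t` vanishes. -/
theorem IsUniversal.bracket_unary_d {L : LieInftyAlgebroid 𝕜 B n F E}
    {𝔉 : SingularFoliation 𝕜 B n M} {R : GeometricResolution F E 𝔉} (hL : L.IsUniversal R)
    {U : Opens M} (j : ℕ) (t : Sec 𝕜 B n (F (j + 1)) (E (j + 1)) U) :
    L.bracket U 1 ![homog 𝕜 B n j ((R.d j).onSec U t)] = 0 := by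
  cases j with
  | zero =>
    -- A section of `E 0` has degree `-1`, so its unary bracket would have degree `0`, where `E` has
    -- no component.
    refine DFinsupp.ext fun m => ?_
    have h := L.bracket_degree U 1 ![0] (Fin.cons ((R.d 0).onSec U t) fun k => k.elim0) m (by
      simp
      omega)
    refine Eq.trans ?_ h
    congr 2
    funext k
    fin_cases k
    rfl
  | succ j =>
    rw [hL.unary_eq]
    have h : (R.d j).onSec U ((R.d (j + 1)).onSec U t) = 0 :=
      Subtype.ext (funext fun x => R.d_d j x (t.1 x))
    rw [h]
    exact map_zero _

/-- The bracket of two exact sections is exact. -/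
theorem IsUniversal.binary_d_mem {L : LieInftyAlgebroid 𝕜 B n F E}
    {𝔉 : SingularFoliation 𝕜 B n M} {R : GeometricResolution F E 𝔉} (hL : L.IsUniversal R)
    {U : Opens M} {i j : ℕ} (s : Sec 𝕜 B n (F (i + 1)) (E (i + 1)) U)
    (t : Sec 𝕜 B n (F (j + 1)) (E (j + 1)) U) (x : M) :
    (L.binary U i j ((R.d i).onSec U s) ((R.d j).onSec U t) (i + j)).1 x ∈
      LinearMap.range ((R.d (i + j)).toFun x) := by
  have h := L.bracket_unary_left s ((R.d j).onSec U t) (hL.bracket_unary_d j t)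
  set z := L.binary U (i + 1) j s ((R.d j).onSec U t) with hz
  -- `unary_eq` speaks of homogeneous elements only, so `z` is identified with its single nonzero
  -- component.
  have hz' : z = homog 𝕜 B n (i + j + 1) (z (i + j + 1)) := by
    refine DFinsupp.ext fun m => ?_
    by_cases hm : m = i + j + 1
    · subst hm
      exact (homog_apply_self _).symm
    · rw [hz, L.binary_degree _ _ (by omega), ← hz]
      exact (homog_apply_of_ne _ hm).symm
  rw [hz', hL.unary_eq, hL.unary_eq] at h
  have h' := congrArg (fun w : GSec 𝕜 B n F E U => (w (i + j)).1 x) h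
  have e : (homog 𝕜 B n (i + j) ((R.d (i + j)).onSec U (z (i + j + 1))) (i + j)).1 x =
      (R.d (i + j)).toFun x ((z (i + j + 1)).1 x) :=
    congrArg (fun w : Sec 𝕜 B n (F (i + j)) (E (i + j)) U => w.1 x) (homog_apply_self _)
  have h'' : (L.binary U i j ((R.d i).onSec U s) ((R.d j).onSec U t) (i + j)).1 x +
      (R.d (i + j)).toFun x ((z (i + j + 1)).1 x) = 0 := e ▸ h'
  rw [eq_neg_of_add_eq_zero_left h'', ← map_neg]
  exact LinearMap.mem_range_self _ _

section Const

variable [∀ i, ContMDiffVectorBundle n (F i) (E i) 𝓘(𝕜, B)]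

/-- The bracket of two elements of the images of `d` is in the image of `d`. -/
theorem IsUniversal.binary_mem_range {L : LieInftyAlgebroid 𝕜 B n F E}
    {𝔉 : SingularFoliation 𝕜 B n M} {R : GeometricResolution F E 𝔉} (hL : L.IsUniversal R)
    {U : Opens M} {i j : ℕ} {x : M} (hx : x ∈ U) (s : Sec 𝕜 B n (F i) (E i) U)
    (t : Sec 𝕜 B n (F j) (E j) U) (hs : s.1 x ∈ LinearMap.range ((R.d i).toFun x))
    (ht : t.1 x ∈ LinearMap.range ((R.d j).toFun x)) :
    (L.binary U i j s t (i + j)).1 x ∈ LinearMap.range ((R.d (i + j)).toFun x) := by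
  have kills (k : ℕ) (w : E k x) (hw : w ∈ LinearMap.range ((R.d k).toFun x)) :
      L.AnchorKills x k w := by
    cases k with
    | zero =>
      obtain ⟨a, rfl⟩ := hw
      have h := R.anchor_d x a
      rw [← hL.anchor_eq] at h
      exact h
    | succ k => trivial
  have ks := kills i _ hs
  have kt := kills j _ ht
  obtain ⟨a, ha⟩ := hs
  obtain ⟨b, hb⟩ := ht
  -- Constant extensions `σ`, `τ` of the preimages `a`, `b`: the exact sections `dσ`, `dτ` have the
  -- same values at `x` as `s`, `t`.
  set W := trivDomain (F (i + 1)) (E (i + 1)) x ⊓ trivDomain (F (j + 1)) (E (j + 1)) x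
  have hW : x ∈ W := ⟨mem_trivDomain x, mem_trivDomain x⟩
  set σ : Sec 𝕜 B n (F (i + 1)) (E (i + 1)) W := Sec.const x inf_le_left
    ((trivializationAt (F (i + 1)) (E (i + 1)) x).linearMapAt 𝕜 x a)
  set τ : Sec 𝕜 B n (F (j + 1)) (E (j + 1)) W := Sec.const x inf_le_right
    ((trivializationAt (F (j + 1)) (E (j + 1)) x).linearMapAt 𝕜 x b)
  have σx : ((R.d i).onSec W σ).1 x = (R.d i).toFun x a :=
    congrArg ((R.d i).toFun x) (Sec.const_linearMapAt x inf_le_left hW a)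
  have τx : ((R.d j).onSec W τ).1 x = (R.d j).toFun x b :=
    congrArg ((R.d j).toFun x) (Sec.const_linearMapAt x inf_le_right hW b)
  rw [L.binary_congr hx hW s t ((R.d i).onSec W σ) ((R.d j).onSec W τ)
    (by rw [σx, ha]) (by rw [τx, hb]) ks kt]
  exact hL.binary_d_mem σ τ x

end Const

end LieInftyAlgebroid

end Algebroids

/-! ### Limits of subspaces in the Grassmann bundle. -/

section Limits

open Filter Topology

/-- Linear maps on a finite-dimensional space that converge pointwise converge along convergent
arguments. -/
theorem LinearMap.tendsto_apply_of_tendsto_pointwise {𝕜 α V W : Type*} [RCLike 𝕜]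
    [NormedAddCommGroup V] [NormedSpace 𝕜 V] [FiniteDimensional 𝕜 V]
    [NormedAddCommGroup W] [NormedSpace 𝕜 W] {l : Filter α}
    {β : α → V →ₗ[𝕜] W} {β₀ : V →ₗ[𝕜] W} (hβ : ∀ v, Tendsto (fun a => β a v) l (𝓝 (β₀ v)))
    {v : α → V} {v₀ : V} (hv : Tendsto v l (𝓝 v₀)) :
    Tendsto (fun a => β a (v a)) l (𝓝 (β₀ v₀)) := by
  set b := Module.finBasis 𝕜 V
  have e (γ : V →ₗ[𝕜] W) (w : V) : γ w = ∑ k, b.coord k w • γ (b k) := by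
    conv_lhs => rw [← b.sum_repr w, map_sum]
    simp
  rw [e β₀ v₀, funext fun a => e (β a) (v a)]
  refine tendsto_finsetSum _ fun k _ => Tendsto.smul ?_ (hβ _)
  exact ((b.coord k).continuous_of_finiteDimensional.tendsto v₀).comp hv

theorem tendsto_clm_apply {𝕜 α V W : Type*} [NontriviallyNormedField 𝕜]
    [NormedAddCommGroup V] [NormedSpace 𝕜 V] [NormedAddCommGroup W] [NormedSpace 𝕜 W]
    {l : Filter α} {T : α → V →L[𝕜] W} {T₀ : V →L[𝕜] W} {v : α → V} {v₀ : V}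
    (hT : Tendsto T l (𝓝 T₀)) (hv : Tendsto v l (𝓝 v₀)) :
    Tendsto (fun a => T a (v a)) l (𝓝 (T₀ v₀)) :=
  (isBoundedBilinearMap_apply.continuous.tendsto (T₀, v₀)).comp (hT.prodMk_nhds hv)

variable {𝕜 : Type*} [RCLike 𝕜] {B : Type*} [NormedAddCommGroup B] [NormedSpace 𝕜 B]
  {M : Type*} [TopologicalSpace M] [ChartedSpace B M] {n : WithTop ℕ∞}

theorem Sec.continuousOn_linearMapAt {F : Type*} [NormedAddCommGroup F] [NormedSpace 𝕜 F]
    {E : M → Type*} [TopologicalSpace (TotalSpace F E)]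
    [∀ x, AddCommGroup (E x)] [∀ x, Module 𝕜 (E x)] [∀ x, TopologicalSpace (E x)]
    [FiberBundle F E] [VectorBundle 𝕜 F E] (x₀ : M) {U : Opens M}
    (hU : U ≤ trivDomain F E x₀) (s : Sec 𝕜 B n F E U) :
    ContinuousOn (fun y => (trivializationAt F E x₀).linearMapAt 𝕜 y (s.1 y)) U := by
  have h : ContinuousOn (fun y => (trivializationAt F E x₀ ⟨y, s.1 y⟩).2) U := by
    refine continuous_snd.comp_continuousOn ?_
    refine (trivializationAt F E x₀).continuousOn.comp s.2.1.continuousOn fun y hy => ?_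
    exact (Trivialization.mem_source _).2 (hU hy)
  refine h.congr fun y hy => ?_
  rw [Trivialization.coe_linearMapAt_of_mem _ (hU hy)]

variable {F : Type*} [NormedAddCommGroup F] [InnerProductSpace 𝕜 F] [FiniteDimensional 𝕜 F]
  {E : M → Type*} [TopologicalSpace (TotalSpace F E)]
  [∀ x, AddCommGroup (E x)] [∀ x, Module 𝕜 (E x)] [∀ x, TopologicalSpace (E x)]
  [FiberBundle F E] [VectorBundle 𝕜 F E]

theorem Gr.tendsto_chart (p : Gr 𝕜 F E) :
    Tendsto (Gr.chart 𝕜 F E p.base) (𝓝 p) (𝓝 (Gr.chart 𝕜 F E p.base p)) := by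
  intro S hS
  obtain ⟨O, hOS, hO, hp⟩ := mem_nhds_iff.1 hS
  have h : IsOpen {q : Gr 𝕜 F E | q.base ∈ (trivializationAt F E p.base).baseSet ∧
      Gr.chart 𝕜 F E p.base q ∈ O} := isOpen_generateFrom_of_mem ⟨p.base, O, hO, rfl⟩
  refine mem_map.2 (mem_of_superset (h.mem_nhds ⟨FiberBundle.mem_baseSet_trivializationAt' p.base, hp⟩)
    fun q hq => hOS hq.2)

/-- Membership becomes the fixed-point equation of a projection, a condition that survives limits.
-/
theorem Gr.mem_space_iff (x₀ : M) (p : Gr 𝕜 F E) (hp : p.base ∈ trivDomain F E x₀)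
    (v : E p.base) :
    v ∈ p.space ↔ (Gr.chart 𝕜 F E x₀ p).2 ((trivializationAt F E x₀).linearMapAt 𝕜 p.base v) =
      (trivializationAt F E x₀).linearMapAt 𝕜 p.base v := by
  rw [Gr.chart, Submodule.starProjection_eq_self_iff, Submodule.mem_map]
  refine ⟨fun h => ⟨v, h, rfl⟩, ?_⟩
  rintro ⟨w, hw, h⟩
  have h' := congrArg ((trivializationAt F E x₀).symmₗ 𝕜 p.base) h
  rw [Trivialization.symmₗ_linearMapAt _ hp, Trivialization.symmₗ_linearMapAt _ hp] at h'
  exact h' ▸ hw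

theorem Gr.symm_chart_mem (x₀ : M) (p : Gr 𝕜 F E) (hp : p.base ∈ trivDomain F E x₀) (f : F) :
    (trivializationAt F E x₀).symmₗ 𝕜 p.base ((Gr.chart 𝕜 F E x₀ p).2 f) ∈ p.space := by
  rw [Gr.mem_space_iff x₀ p hp, Trivialization.linearMapAt_symmₗ _ hp, Gr.chart]
  exact Submodule.starProjection_eq_self_iff.2 (Submodule.starProjection_apply_mem _ _)

section Family

variable {l : Filter M} {W : ∀ y : M, Submodule 𝕜 (E y)} {x : M} {V : Submodule 𝕜 (E x)}

theorem Gr.tendsto_base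
    (h : Tendsto (fun y => (⟨y, W y⟩ : Gr 𝕜 F E)) l (𝓝 ⟨x, V⟩)) :
    Tendsto id l (𝓝 x) :=
  (continuous_fst.tendsto _).comp ((Gr.tendsto_chart (⟨x, V⟩ : Gr 𝕜 F E)).comp h)

theorem Gr.tendsto_projection
    (h : Tendsto (fun y => (⟨y, W y⟩ : Gr 𝕜 F E)) l (𝓝 ⟨x, V⟩)) :
    Tendsto (fun y => (Gr.chart 𝕜 F E x ⟨y, W y⟩).2) l (𝓝 (Gr.chart 𝕜 F E x ⟨x, V⟩).2) :=
  (continuous_snd.tendsto _).comp ((Gr.tendsto_chart (⟨x, V⟩ : Gr 𝕜 F E)).comp h)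

/-- Every element of a limit of subspaces is a limit of elements of these subspaces. -/
theorem Gr.exists_tendsto_of_mem
    (h : Tendsto (fun y => (⟨y, W y⟩ : Gr 𝕜 F E)) l (𝓝 ⟨x, V⟩))
    {u : E x} (hu : u ∈ V) :
    ∃ f : M → F, Tendsto f l (𝓝 ((trivializationAt F E x).linearMapAt 𝕜 x u)) ∧
      ∀ y ∈ trivDomain F E x, (trivializationAt F E x).symmₗ 𝕜 y (f y) ∈ W y := by
  -- Project the fixed coordinate vector of `u` onto each subspace; the limiting projection fixes it
  -- because `u ∈ V`.
  refine ⟨fun y => (Gr.chart 𝕜 F E x ⟨y, W y⟩).2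
    ((trivializationAt F E x).linearMapAt 𝕜 x u), ?_, fun y hy => ?_⟩
  · have h' := tendsto_clm_apply (Gr.tendsto_projection (F := F) h)
      (tendsto_const_nhds (x := (trivializationAt F E x).linearMapAt 𝕜 x u))
    rwa [(Gr.mem_space_iff (F := F) x ⟨x, V⟩ (mem_trivDomain x) u).1 hu] at h'
  · exact Gr.symm_chart_mem x ⟨y, W y⟩ hy _

/-- A limit of elements of a converging family of subspaces is in the limit. -/
theorem Gr.mem_of_tendsto [l.NeBot]
    (h : Tendsto (fun y => (⟨y, W y⟩ : Gr 𝕜 F E)) l (𝓝 ⟨x, V⟩))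
    {w : ∀ y, E y} {w₀ : E x} (hw : ∀ᶠ y in l, w y ∈ W y)
    (hx : Tendsto (fun y => (trivializationAt F E x).linearMapAt 𝕜 y (w y)) l
      (𝓝 ((trivializationAt F E x).linearMapAt 𝕜 x w₀))) : w₀ ∈ V := by
  refine (Gr.mem_space_iff (F := F) x ⟨x, V⟩ (mem_trivDomain x) w₀).2 ?_
  -- The projection of `w y` onto `W y` is eventually `w y` itself, so the limiting projection fixes
  -- the limit.
  refine tendsto_nhds_unique
    ((tendsto_clm_apply (Gr.tendsto_projection (F := F) h) hx).congr' ?_) hx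
  have hU : ∀ᶠ y in l, y ∈ trivDomain F E x :=
    Gr.tendsto_base (F := F) h ((trivDomain F E x).isOpen.mem_nhds (mem_trivDomain x))
  filter_upwards [hw, hU] with y hy hyU
  exact (Gr.mem_space_iff (F := F) x ⟨y, W y⟩ hyU _).1 hy

end Family

end Limits

/-! ### Passing to the limit for the anchor and the bracket. -/

section Algebroids

variable {𝕜 : Type*} [RCLike 𝕜] {B : Type*} [NormedAddCommGroup B] [NormedSpace 𝕜 B]
  {n : WithTop ℕ∞} {M : Type*} [TopologicalSpace M] [ChartedSpace B M]
  [IsManifold 𝓘(𝕜, B) 1 M]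
  {F : ℕ → Type*} [∀ i, NormedAddCommGroup (F i)] [∀ i, InnerProductSpace 𝕜 (F i)]
  [∀ i, FiniteDimensional 𝕜 (F i)]
  {E : ℕ → M → Type*} [∀ i, TopologicalSpace (TotalSpace (F i) (E i))]
  [∀ i x, AddCommGroup (E i x)] [∀ i x, Module 𝕜 (E i x)] [∀ i x, TopologicalSpace (E i x)]
  [∀ i, FiberBundle (F i) (E i)] [∀ i, VectorBundle 𝕜 (F i) (E i)]

open Filter Topology

namespace LieInftyAlgebroid

variable {L : LieInftyAlgebroid 𝕜 B n F E} [∀ i, ContMDiffVectorBundle n (F i) (E i) 𝓘(𝕜, B)]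
  {𝔉 : SingularFoliation 𝕜 B n M} {R : GeometricResolution F E 𝔉}

/-- A limit of the images of `d` is in the kernel of the anchor. -/
theorem _root_.GeometricResolution.anchor_eq_zero_of_tendsto (R : GeometricResolution F E 𝔉)
    {l : Filter M} [l.NeBot] {x : M}
    {V : Submodule 𝕜 (E 0 x)}
    (h : Tendsto (fun y => (⟨y, LinearMap.range ((R.d 0).toFun y)⟩ : Gr 𝕜 (F 0) (E 0))) l
      (𝓝 ⟨x, V⟩)) : V ≤ LinearMap.ker (R.anchor.toFun x) := by
  intro u hu
  obtain ⟨f, hf, hfV⟩ := Gr.exists_tendsto_of_mem (F := F 0) h hu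
  set U := trivDomain (F 0) (E 0) x ⊓ trivDomain B (TangentSpace 𝓘(𝕜, B) : M → Type _) x
  have hx : x ∈ U := ⟨mem_trivDomain x, mem_trivDomain x⟩
  have hU : ∀ᶠ y in l, y ∈ U := Gr.tendsto_base (F := F 0) h (U.isOpen.mem_nhds hx)
  set κ : F 0 →ₗ[𝕜] Sec 𝕜 B n (F 0) (E 0) U := Sec.const x inf_le_left
  set e := trivializationAt B (TangentSpace 𝓘(𝕜, B) : M → Type _) x
  -- `β y v` is the anchor at `y`, in coordinates, of the constant section with parameter `v`. The
  -- section tested at `y` is `κ (f y)`, which varies with `y`; linearity in `v` makes convergence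
  -- for each fixed `v` sufficient.
  let β (y : M) : F 0 →ₗ[𝕜] B := (e.linearMapAt 𝕜 y).comp ((LinearMap.proj y).comp
    ((Submodule.subtype _).comp ((R.anchor.onSec U).comp κ)))
  have hβ (v : F 0) : Tendsto (fun y => β y v) l (𝓝 (β x v)) := by
    have hc := Sec.continuousOn_linearMapAt x inf_le_right (R.anchor.onSec U (κ v))
    exact (hc.continuousAt (U.isOpen.mem_nhds hx)).tendsto.comp (Gr.tendsto_base (F := F 0) h)
  have hlim := LinearMap.tendsto_apply_of_tendsto_pointwise hβ hf
  have hzero : ∀ᶠ y in l, β y (f y) = 0 := by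
    filter_upwards [hU] with y hy
    obtain ⟨a, ha⟩ := hfV y hy.1
    have h₀ : (R.anchor.onSec U (κ (f y))).1 y = 0 := by
      refine (congrArg (R.anchor.toFun y) (Sec.const_apply x inf_le_left (f y) hy)).trans ?_
      rw [← ha]
      exact R.anchor_d y a
    exact (congrArg (e.linearMapAt 𝕜 y) h₀).trans (map_zero _)
  have hx₀ : β x ((trivializationAt (F 0) (E 0) x).linearMapAt 𝕜 x u) = 0 :=
    tendsto_nhds_unique (hlim.congr' hzero) tendsto_const_nhds
  have hx₁ : e.linearMapAt 𝕜 x (R.anchor.toFun x u) = 0 := by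
    refine Eq.trans ?_ hx₀
    exact congrArg (fun w => e.linearMapAt 𝕜 x (R.anchor.toFun x w))
      (Sec.const_linearMapAt x inf_le_left hx u).symm
  have hx₂ := congrArg (e.symmₗ 𝕜 x) hx₁
  rwa [Trivialization.symmₗ_linearMapAt _ (mem_trivDomain x), map_zero] at hx₂

/-- The bracket of elements of limits of the images of `d` is well defined, and it is an element
of the limit of the images of `d`. -/
theorem IsUniversal.exists_isBracketAt_iff_of_tendsto (hL : L.IsUniversal R)
    {l : Filter M} [l.NeBot] {x : M} {i j : ℕ} {V : Submodule 𝕜 (E i x)}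
    {V' : Submodule 𝕜 (E j x)} {V'' : Submodule 𝕜 (E (i + j) x)}
    (h : Tendsto (fun y => (⟨y, LinearMap.range ((R.d i).toFun y)⟩ : Gr 𝕜 (F i) (E i))) l
      (𝓝 ⟨x, V⟩))
    (h' : Tendsto (fun y => (⟨y, LinearMap.range ((R.d j).toFun y)⟩ : Gr 𝕜 (F j) (E j))) l
      (𝓝 ⟨x, V'⟩))
    (h'' : Tendsto (fun y => (⟨y, LinearMap.range ((R.d (i + j)).toFun y)⟩ :
      Gr 𝕜 (F (i + j)) (E (i + j)))) l (𝓝 ⟨x, V''⟩))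
    {u : E i x} (hu : u ∈ V) {v : E j x} (hv : v ∈ V') :
    ∃ w ∈ V'', ∀ w', L.IsBracketAt x u v w' ↔ w' = w := by
  have ku : L.AnchorKills x i u := by
    cases i with
    | zero =>
      have := R.anchor_eq_zero_of_tendsto h hu
      rwa [← hL.anchor_eq] at this
    | succ i => trivial
  have kv : L.AnchorKills x j v := by
    cases j with
    | zero =>
      have := R.anchor_eq_zero_of_tendsto h' hv
      rwa [← hL.anchor_eq] at this
    | succ j => trivial
  obtain ⟨f, hf, hfV⟩ := Gr.exists_tendsto_of_mem (F := F i) h hu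
  obtain ⟨g, hg, hgV⟩ := Gr.exists_tendsto_of_mem (F := F j) h' hv
  set U := trivDomain (F i) (E i) x ⊓ trivDomain (F j) (E j) x ⊓
    trivDomain (F (i + j)) (E (i + j)) x
  have hx : x ∈ U := ⟨⟨mem_trivDomain x, mem_trivDomain x⟩, mem_trivDomain x⟩
  have hU : ∀ᶠ y in l, y ∈ U := Gr.tendsto_base (F := F i) h (U.isOpen.mem_nhds hx)
  have hUi : U ≤ trivDomain (F i) (E i) x := inf_le_left.trans inf_le_left
  have hUj : U ≤ trivDomain (F j) (E j) x := inf_le_left.trans inf_le_right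
  set κ : F i →ₗ[𝕜] Sec 𝕜 B n (F i) (E i) U := Sec.const x hUi
  set μ : F j →ₗ[𝕜] Sec 𝕜 B n (F j) (E j) U := Sec.const x hUj
  set e := trivializationAt (F (i + j)) (E (i + j)) x
  -- The bracket of two constant sections evaluated at `y`, in coordinates, as a bilinear map of
  -- their parameters.
  let β (y : M) : F i →ₗ[𝕜] F j →ₗ[𝕜] F (i + j) :=
    ((L.binary U i j).compl₁₂ κ μ).compr₂ ((e.linearMapAt 𝕜 y).comp ((LinearMap.proj y).comp
      ((Submodule.subtype _).comp
        (DirectSum.component 𝕜 ℕ (fun i => Sec 𝕜 B n (F i) (E i) U) (i + j)))))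
  have hβ (p : F i) (q : F j) : Tendsto (fun y => β y p q) l (𝓝 (β x p q)) := by
    have hc := Sec.continuousOn_linearMapAt x inf_le_right
      (L.binary U i j (κ p) (μ q) (i + j))
    exact (hc.continuousAt (U.isOpen.mem_nhds hx)).tendsto.comp (Gr.tendsto_base (F := F i) h)
  -- The two parameters are made to vary one at a time: here the second, then the first through
  -- `flip`.
  have hβ₁ (p : F i) := LinearMap.tendsto_apply_of_tendsto_pointwise (hβ p) hg
  have hlim := LinearMap.tendsto_apply_of_tendsto_pointwise
    (β := fun y => (β y).flip (g y)) (β₀ := (β x).flip _) hβ₁ hf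
  have κx : (κ ((trivializationAt (F i) (E i) x).linearMapAt 𝕜 x u)).1 x = u :=
    Sec.const_linearMapAt x hUi hx u
  have μx : (μ ((trivializationAt (F j) (E j) x).linearMapAt 𝕜 x v)).1 x = v :=
    Sec.const_linearMapAt x hUj hx v
  set s := κ ((trivializationAt (F i) (E i) x).linearMapAt 𝕜 x u)
  set t := μ ((trivializationAt (F j) (E j) x).linearMapAt 𝕜 x v)
  refine ⟨(L.binary U i j s t (i + j)).1 x, ?_, fun w' => ⟨?_, ?_⟩⟩
  · refine Gr.mem_of_tendsto (F := F (i + j)) h''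
      (w := fun y => (L.binary U i j (κ (f y)) (μ (g y)) (i + j)).1 y) ?_ hlim
    filter_upwards [hU] with y hy
    refine hL.binary_mem_range hy _ _ ?_ ?_
    · rw [Sec.const_apply x hUi (f y) hy]
      exact hfV y hy.1.1
    · rw [Sec.const_apply x hUj (g y) hy]
      exact hgV y hy.1.2
  · rintro ⟨U', hx', s', t', hs', ht', rfl⟩
    exact L.binary_congr hx' hx s' t' s t (hs'.trans κx.symm) (ht'.trans μx.symm)
      (by rwa [hs']) (by rwa [ht']) _
  · rintro rfl
    exact ⟨U, hx, s, t, κx, μx, rfl⟩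

end LieInftyAlgebroid

end Algebroids

/-- Pulling back the neighbourhood filter of `p` gives one filter on the base along which all
Grassmannian components converge simultaneously. -/
theorem exists_tendsto_of_mem_closure {X Y : Type*} [TopologicalSpace Y] {g : X → Y} {S : Set Y}
    (hS : S ⊆ Set.range g) {p : Y} (hp : p ∈ closure S) :
    ∃ l : Filter X, l.NeBot ∧ Filter.Tendsto g l (nhds p) := by
  refine ⟨Filter.comap g (nhds p), Filter.comap_neBot fun t ht => ?_, Filter.tendsto_comap⟩
  obtain ⟨_, hzt, hzS⟩ := mem_closure_iff_nhds.1 hp t ht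
  obtain ⟨y, rfl⟩ := hS hzS
  exact ⟨y, hzt⟩

theorem mainTheorem6 {𝕜 : Type*} [RCLike 𝕜]
    {B : Type*} [NormedAddCommGroup B] [NormedSpace 𝕜 B] [FiniteDimensional 𝕜 B]
    {n : WithTop ℕ∞} (hn : ∞ ≤ n)
    {M : Type*} [TopologicalSpace M] [T2Space M] [SecondCountableTopology M]
    [ChartedSpace B M] [IsManifold 𝓘(𝕜, B) n M] [IsManifold 𝓘(𝕜, B) 1 M]
    {F : ℕ → Type*} [∀ i, NormedAddCommGroup (F i)] [∀ i, InnerProductSpace 𝕜 (F i)]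
    [∀ i, FiniteDimensional 𝕜 (F i)]
    {E : ℕ → M → Type*} [∀ i, TopologicalSpace (TotalSpace (F i) (E i))]
    [∀ i x, AddCommGroup (E i x)] [∀ i x, Module 𝕜 (E i x)] [∀ i x, TopologicalSpace (E i x)]
    [∀ i, FiberBundle (F i) (E i)] [∀ i, VectorBundle 𝕜 (F i) (E i)]
    [∀ i, ContMDiffVectorBundle n (F i) (E i) 𝓘(𝕜, B)]
    (𝔉 : SingularFoliation 𝕜 B n M) (R : GeometricResolution F E 𝔉)
    (L : LieInftyAlgebroid 𝕜 B n F E) (hL : L.IsUniversal R) :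
    (∀ (x : M) (V : Submodule 𝕜 (E 0 x)),
      (⟨x, V⟩ : Gr 𝕜 (F 0) (E 0)) ∈ (R.d 0).nashBlowup →
        V ≤ LinearMap.ker (R.anchor.toFun x) ∧
        ∀ u ∈ V, ∀ v ∈ V, ∃ w ∈ V, ∀ w' : E 0 x, L.IsBracketAt x (i := 0) (j := 0) u v w' ↔ w' = w) ∧
    (∀ (x : M) (V : ∀ i, Submodule 𝕜 (E i x)),
      (⟨x, V⟩ : GrProd 𝕜 F E) ∈ R.lastBlowup →
        V 0 ≤ LinearMap.ker (R.anchor.toFun x) ∧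
        ∀ i j, ∀ u ∈ V i, ∀ v ∈ V j,
          ∃ w ∈ V (i + j), ∀ w', L.IsBracketAt x u v w' ↔ w' = w) := by
  constructor
  · intro x V hV
    obtain ⟨l, hl, h⟩ := exists_tendsto_of_mem_closure
      (g := fun y => (⟨y, LinearMap.range ((R.d 0).toFun y)⟩ : Gr 𝕜 (F 0) (E 0)))
      (by rintro _ ⟨y, -, rfl⟩; exact ⟨y, rfl⟩) hV
    -- For `i = j = 0` the target index is again `0`, so a single convergence serves for both
    -- entries and for the bracket.
    exact ⟨R.anchor_eq_zero_of_tendsto h, fun u hu v hv =>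
      hL.exists_isBracketAt_iff_of_tendsto (i := 0) (j := 0) h h h hu hv⟩
  · intro x V hV
    obtain ⟨l, hl, h⟩ := exists_tendsto_of_mem_closure
      (g := fun y => (⟨y, fun i => LinearMap.range ((R.d i).toFun y)⟩ : GrProd 𝕜 F E))
      (by rintro _ ⟨y, -, rfl⟩; exact ⟨y, rfl⟩) hV
    have h' (i : ℕ) : Filter.Tendsto
        (fun y => (⟨y, LinearMap.range ((R.d i).toFun y)⟩ : Gr 𝕜 (F i) (E i))) l
        (nhds ⟨x, V i⟩) :=
      (((continuous_apply i).comp continuous_induced_dom).tendsto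
        (⟨x, V⟩ : GrProd 𝕜 F E)).comp h
    exact ⟨R.anchor_eq_zero_of_tendsto (h' 0), fun i j u hu v hv =>
      hL.exists_isBracketAt_iff_of_tendsto (h' i) (h' j) (h' (i + j)) hu hv⟩
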